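/- All rings are commutative and unital, and $\mathscr{L}=\{+,-,\cdot,0,1\}$ is the language of rings. A ring $A$ is \emph{real closed} if (i) $A$ is reduced; (ii) the set of squares of $A$ is the set of non-negative elements of a partial order $\leq$ on $A$ making $A$ an $f$-ring, i.e. $(A,\leq)$ is a partially ordered ring in which $a\vee b$ and $a\wedge b$ exist for all $a,b$, and $c(a\wedge b)=ca\wedge cb$ for all $a, b$ and all $c\geq 0$; (iii) if $0\leq a\leq b$, then $bc=a^2$ for some $c\in A$; (iv) for every prime ideal $\mathfrak p$ of $A$, the domain $A/\mathfrak p$ is integrally closed and its quotient field is a real closed field. The \emph{rank} of $A$ at a prime $\mathfrak p$ is the number (in $\mathbb N\cup\{\infty\}$) of minimal prime ideals of $A$ contained in $\mathfrak p$, and the rank of $A$ is the supremum of its ranks at all primes. A prime ideal $\mathfrak q$ is \emph{branching} if $\mathfrak q=\mathfrak q_1+\mathfrak q_2$ for distinct prime ideals $\mathfrak q_1,\mathfrak q_2\subsetneq\mathfrak q$. For a local real closed ring $A$ of finite rank with maximal ideal $\mathfrak m_A$, the \emph{branching spectrum} $\mathrm{BrSpec}(A)$ is the set consisting of the minimal prime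 ideals of $A$, of $\mathfrak m_A$, and of the branching ideals of $A$, ordered by inclusion. A \emph{root} is a poset $(P,\sqsubseteq)$ with a greatest element $\top$ in which $p^{\uparrow}=\{q\in P: p\sqsubseteq q\}$ is a chain for every $p\in P$. An element $q\in P$ is a \emph{branching point} if there are $p_1,p_2\in P$ strictly below $q$ such that $q$ is the unique minimal element of $p_1^{\uparrow}\cap p_2^{\uparrow}$. A finite root $P$ is \emph{reduced} if each of its elements is minimal, equal to $\top$, or a branching point; its \emph{rank} is its number of minimal elements. \textbf{Statement.} (1) For every finite reduced root $(P,\sqsubseteq)$ of rank at least $2$ there exists an $\mathscr{L}$-sentence $\varphi_P$ such that, for every local real closed ring $A$ of finite rank, $A\models\varphi_P$ if and only if $(\mathrm{BrSpec}(A),\subseteq)\cong(P,\sqsubseteq)$ as posets. (2) Let $A$ and $B$ be local real closed rings of finite rank. If $A$ and $B$ are elementarily equivalent in $\mathscr{L}$, then $(\mathrm{BrSpec}(A),\subseteq)\cong(\mathrm{BrSpec}(B),\subseteq)$ as posets. -/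

import Mathlib

namespace BranchRCR

/-- A real closed ring: a reduced ring whose squares are the non-negative elements of a partial
order making it an `f`-ring, such that `0 ≤ a ≤ b` implies `b ∣ a ^ 2`, and all of whose residue
domains are integrally closed with real closed quotient field.  The zero ring is allowed. -/
structure IsRealClosedRing (A : Type*) [CommRing A] : Prop where
  reduced : IsReduced A
  order : ∃ (_ : Lattice A) (_ : IsOrderedRing A),
    (∀ a : A, 0 ≤ a ↔ IsSquare a) ∧
    (∀ a b c : A, 0 ≤ c → c * (a ⊓ b) = c * a ⊓ c * b) ∧
    (∀ a b : A, 0 ≤ a → a ≤ b → ∃ c : A, b * c = a ^ 2)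
  residue : ∀ (p : Ideal A) [p.IsPrime],
    IsRealClosed (FractionRing (A ⧸ p)) ∧ IsIntegrallyClosed (A ⧸ p)

/-- The rank of a ring at a prime ideal: the number of minimal prime ideals below it. -/
noncomputable def rankAt (A : Type*) [CommRing A] (p : PrimeSpectrum A) : ℕ∞ :=
  {q : PrimeSpectrum A | q.asIdeal ∈ minimalPrimes A ∧ q ≤ p}.encard

/-- The rank of a ring: the supremum of the ranks at its prime ideals. -/
noncomputable def ringRank (A : Type*) [CommRing A] : ℕ∞ :=
  ⨆ p : PrimeSpectrum A, rankAt A p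

/-- A prime ideal is branching if it is the sum of two distinct prime ideals properly contained
in it. -/
def IsBranchingIdeal {A : Type*} [CommRing A] (q : PrimeSpectrum A) : Prop :=
  ∃ q₁ q₂ : PrimeSpectrum A, q₁ ≠ q₂ ∧ q₁ < q ∧ q₂ < q ∧ q.asIdeal = q₁.asIdeal + q₂.asIdeal

/-- The branching spectrum of a local ring: the minimal primes, the maximal ideal and the
branching ideals.  It is ordered by inclusion, as a subset of the prime spectrum. -/
def BrSpec (A : Type*) [CommRing A] [IsLocalRing A] : Set (PrimeSpectrum A) :=
  {p | p.asIdeal ∈ minimalPrimes A} ∪ {IsLocalRing.closedPoint A} ∪ {p | IsBranchingIdeal p}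

/-- A root system: a poset in which all principal up-sets are chains. -/
def IsRootSystem (P : Type*) [PartialOrder P] : Prop :=
  ∀ p : P, IsChain (· ≤ ·) (Set.Ici p)

/-- A root: a root system with a greatest element. -/
def IsRoot (P : Type*) [PartialOrder P] : Prop :=
  IsRootSystem P ∧ ∃ t : P, IsTop t

/-- `q` is a branching point if there are `p₁, p₂ < q` such that `q` is the only minimal element
of the set of common upper bounds of `p₁` and `p₂`. -/
def IsBranchingPoint {P : Type*} [PartialOrder P] (q : P) : Prop :=
  ∃ p₁ p₂ : P, p₁ < q ∧ p₂ < q ∧ {q} = {x : P | Minimal (· ∈ Set.Ici p₁ ∩ Set.Ici p₂) x}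

/-- The branching root: the minimal elements, the greatest element and the branching points. -/
def branchingRoot (P : Type*) [PartialOrder P] : Set P :=
  {p | IsMin p} ∪ {p | IsTop p} ∪ {p | IsBranchingPoint p}

/-- A reduced root: a root that coincides with its branching root. -/
def IsReducedRoot (P : Type*) [PartialOrder P] : Prop :=
  IsRoot P ∧ branchingRoot P = Set.univ

/-- The rank of a (finite) root: its number of minimal elements. -/
noncomputable def rootRank (P : Type*) [PartialOrder P] : ℕ :=
  {p : P | IsMin p}.ncard

end BranchRCR

open scoped FirstOrder

universe u v w

/-! In a real closed ring primes are convex, the primes above a given prime form a chain, and in the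
local case a sum of two primes is prime. Hence branching ideals are exactly the sums of two distinct
minimal primes (`isBranchingIdeal_iff`), and the branching spectrum is known once the minimal primes
are.

Finite rank leaves finitely many minimal primes `p i`. As the ring is reduced, each is the
annihilator of an element `a i` lying in all the others, and the families `a` arising this way have
a first-order description (`IsOrthogonalPrimeFamily`). Membership in `Ann (a i) + Ann (a j)` and in
the maximal ideal is first-order too, so each inclusion pattern among these ideals is expressible.
For a finite poset `P`, a finite disjunction over the possible patterns gives the sentence. Part (2)
applies this sentence to `P = BrSpec A`, which is finite. -/

namespace BranchRCR

/-! ### Convex and prime ideals in `f`-rings -/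

section LatticeOrderedRing

variable {A : Type*} [CommRing A] [Lattice A] [IsOrderedRing A]

/-- Multiplying `u ⊓ v = 0` by `v` and by `u` makes `u * v` disjoint from both squares. But `u * v ≤
u * u + v * v`, so disjointness from `u * u` forces `u * v ≤ v * v`, and then `u * v = u * v ⊓ v * v
= 0`. -/
theorem mul_eq_zero_of_inf_eq_zero
    (hsq : ∀ a : A, 0 ≤ a * a)
    (hmul : ∀ a b c : A, 0 ≤ c → c * (a ⊓ b) = c * a ⊓ c * b)
    {u v : A} (hu : 0 ≤ u) (hv : 0 ≤ v) (huv : u ⊓ v = 0) : u * v = 0 := by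
  have h1 : u * v ⊓ v * v = 0 := by
    rw [mul_comm u v, ← hmul _ _ _ hv, huv, mul_zero]
  have h2 : u * v ⊓ u * u = 0 := by
    rw [← hmul _ _ _ hu, inf_comm, huv, mul_zero]
  have huv0 : 0 ≤ u * v := mul_nonneg hu hv
  have hle : u * v ≤ u * u + v * v := by
    have := hsq (u - v)
    have h3 : u * v + u * v ≤ u * u + v * v := by
      rw [← sub_nonneg]
      convert this using 1
      ring
    exact (le_add_of_nonneg_left huv0).trans h3
  have h4 : u * v - (u * v ⊓ u * u) ≤ v * v := by
    rw [sub_le_iff_le_add, add_inf]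
    refine le_inf (le_add_of_nonneg_left (hsq v)) ?_
    rwa [add_comm]
  rw [h2, sub_zero] at h4
  rwa [inf_eq_left.2 h4] at h1

theorem posPart_mul_negPart
    (hsq : ∀ a : A, 0 ≤ a * a)
    (hmul : ∀ a b c : A, 0 ≤ c → c * (a ⊓ b) = c * a ⊓ c * b) (a : A) : a⁺ * a⁻ = 0 :=
  mul_eq_zero_of_inf_eq_zero hsq hmul (posPart_nonneg a) (negPart_nonneg a)
    (posPart_inf_negPart_eq_zero a)

theorem abs_mul_abs_of_posPart_mul_negPart (hpn : ∀ a : A, a⁺ * a⁻ = 0) (a : A) :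
    |a| * |a| = a * a := by
  have h1 := posPart_add_negPart a
  have h2 := posPart_sub_negPart a
  linear_combination (-|a| - (a⁺ + a⁻)) * h1 + (a + (a⁺ - a⁻)) * h2 + 4 * hpn a

/-- For `w = (c - d)⁺` one has `w * (c - d) = w * w`, so multiplying the hypothesis by `w` gives `w
* w * (c + d) ≤ 0`. Since `w ≤ c`, this forces `w ^ 3 = 0`. -/
theorem le_of_mul_self_le_mul_self [IsReduced A] (hpn : ∀ a : A, a⁺ * a⁻ = 0)
    {c d : A} (hc : 0 ≤ c) (hd : 0 ≤ d) (h : c * c ≤ d * d) : c ≤ d := by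
  set w := (c - d)⁺ with hw
  have hw0 : 0 ≤ w := posPart_nonneg _
  have hwc : w ≤ c := by
    rw [hw, posPart_def]
    exact sup_le (sub_le_self _ hd) hc
  have hww : w * (c - d) = w * w := by
    have h1 := posPart_sub_negPart (c - d)
    linear_combination -w * h1 - hpn (c - d)
  have h0 : w * w * (c + d) ≤ 0 := by
    have h1 : w * (d * d - c * c) = -(w * w * (c + d)) := by
      linear_combination (-(c + d)) * hww
    have h2 := mul_nonneg hw0 (sub_nonneg.2 h)
    rwa [h1, Left.nonneg_neg_iff] at h2
  have hw3 : w * w * w = 0 := by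
    refine le_antisymm (le_trans ?_ h0) (mul_nonneg (mul_nonneg hw0 hw0) hw0)
    exact mul_le_mul_of_nonneg_left (hwc.trans (le_add_of_nonneg_right hd)) (mul_nonneg hw0 hw0)
  have hz : w = 0 := by
    refine pow_eq_zero_iff (n := 3) (by norm_num) |>.1 ?_
    rw [← hw3]
    ring
  rw [hw, posPart_eq_zero] at hz
  exact sub_nonpos.1 hz

/-- An ideal of a partially ordered ring is convex if its non-negative elements form a
lower set of the non-negative elements. -/
def IsConvexIdeal {A : Type*} [CommRing A] [PartialOrder A] (I : Ideal A) : Prop :=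
  ∀ ⦃a b : A⦄, 0 ≤ a → a ≤ b → b ∈ I → a ∈ I

theorem IsConvexIdeal.mem_of_abs_mem {I : Ideal A} (hI : IsConvexIdeal I) {a : A}
    (ha : |a| ∈ I) : a ∈ I := by
  have h := posPart_add_negPart a
  have h1 : a⁺ ∈ I := hI (posPart_nonneg a)
    (h ▸ le_add_of_nonneg_right (negPart_nonneg a)) ha
  have h2 : a⁻ ∈ I := hI (negPart_nonneg a)
    (h ▸ le_add_of_nonneg_left (posPart_nonneg a)) ha
  rw [← posPart_sub_negPart a]
  exact I.sub_mem h1 h2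

theorem abs_mem_of_mem (hpn : ∀ a : A, a⁺ * a⁻ = 0) {p : Ideal A} (hp : p.IsPrime) {a : A}
    (ha : a ∈ p) : |a| ∈ p := by
  have : |a| * |a| ∈ p := by
    rw [abs_mul_abs_of_posPart_mul_negPart hpn]
    exact p.mul_mem_left _ ha
  exact (hp.mem_or_mem this).elim id id

/-- The two differences are `(a - b)⁺` and `(a - b)⁻`, whose product is zero. In effect, any two
elements become comparable modulo a prime. -/
theorem sub_inf_mem_or_sub_inf_mem (hpn : ∀ a : A, a⁺ * a⁻ = 0) {p : Ideal A} (hp : p.IsPrime)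
    (a b : A) : a - a ⊓ b ∈ p ∨ b - a ⊓ b ∈ p := by
  have h1 : a - a ⊓ b = (a - b)⁺ := by rw [inf_eq_sub_posPart_sub a b, sub_sub_cancel]
  have h2 : b - a ⊓ b = (a - b)⁻ := by
    rw [inf_comm, inf_eq_sub_posPart_sub b a, sub_sub_cancel, ← neg_sub a b, posPart_neg]
  rw [h1, h2]
  exact hp.mem_or_mem ((hpn _).symm ▸ p.zero_mem)

/-- Riesz decomposition: if `0 ≤ a ≤ |x| + |y|`, then `a ⊓ |x| ≤ |x|` and `a - a ⊓ |x| ≤ |y|`. -/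
theorem IsConvexIdeal.add (hpn : ∀ a : A, a⁺ * a⁻ = 0) {p q : Ideal A}
    (hp : p.IsPrime) (hq : q.IsPrime) (hpc : IsConvexIdeal p) (hqc : IsConvexIdeal q) :
    IsConvexIdeal (p + q) := by
  intro a b ha hab hb
  obtain ⟨x, hx, y, hy, rfl⟩ := Submodule.mem_sup.1 hb
  have h1 : a ⊓ |x| ∈ p := hpc (le_inf ha (abs_nonneg x)) inf_le_right (abs_mem_of_mem hpn hp hx)
  have h2 : a - a ⊓ |x| ∈ q := by
    refine hqc (sub_nonneg.2 inf_le_left) ?_ (abs_mem_of_mem hpn hq hy)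
    rw [sub_le_iff_le_add, add_inf]
    refine le_inf (le_add_of_nonneg_left (abs_nonneg y)) (hab.trans ?_)
    rw [add_comm |y|]
    exact add_le_add (le_abs_self x) (le_abs_self y)
  exact Submodule.mem_sup.2 ⟨_, h1, _, h2, by abel⟩

/-- Absolute values are squares: with `a * a = x + y`, `|x| = s * s` and `|y| = t * t`, one gets
`|a| ≤ s + t` by comparing squares, and convexity finishes. -/
theorem mem_add_of_mul_self_mem [IsReduced A] (hsq : ∀ a : A, 0 ≤ a ↔ IsSquare a)
    (hpn : ∀ a : A, a⁺ * a⁻ = 0) {p q : Ideal A}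
    (hp : p.IsPrime) (hq : q.IsPrime) (hpc : IsConvexIdeal p) (hqc : IsConvexIdeal q)
    {a : A} (ha : a * a ∈ p + q) : a ∈ p + q := by
  have key : ∀ {r : Ideal A}, r.IsPrime → ∀ x ∈ r, ∃ s ∈ r, 0 ≤ s ∧ |x| = s * s := by
    intro r hr x hx
    obtain ⟨s, hs⟩ := (hsq |x|).1 (abs_nonneg x)
    have hs' : s * s ∈ r := hs ▸ abs_mem_of_mem hpn hr hx
    refine ⟨|s|, abs_mem_of_mem hpn hr ((hr.mem_or_mem hs').elim id id), abs_nonneg s, ?_⟩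
    rw [hs, abs_mul_abs_of_posPart_mul_negPart hpn]
  obtain ⟨x, hx, y, hy, hxy⟩ := Submodule.mem_sup.1 ha
  obtain ⟨s, hs, hs0, hxs⟩ := key hp x hx
  obtain ⟨t, ht, ht0, hyt⟩ := key hq y hy
  have hst : |a| ≤ s + t := by
    refine le_of_mul_self_le_mul_self hpn (abs_nonneg a) (add_nonneg hs0 ht0) ?_
    rw [abs_mul_abs_of_posPart_mul_negPart hpn, ← hxy]
    calc x + y ≤ |x| + |y| := add_le_add (le_abs_self x) (le_abs_self y)
      _ = s * s + t * t := by rw [hxs, hyt]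
      _ ≤ s * s + t * t + (s * t + s * t) :=
        le_add_of_nonneg_right (add_nonneg (mul_nonneg hs0 ht0) (mul_nonneg hs0 ht0))
      _ = (s + t) * (s + t) := by ring
  have hc := IsConvexIdeal.add hpn hp hq hpc hqc
  exact hc.mem_of_abs_mem (hc (abs_nonneg a) hst (Submodule.mem_sup.2 ⟨s, hs, t, ht, rfl⟩))

/-- Modulo `p`, one of `|a|`, `|b|` equals `|a| ⊓ |b|`, whose square is at most `|a| * |b|`. -/
theorem mem_or_mem_of_mul_mem (hpn : ∀ a : A, a⁺ * a⁻ = 0) {p I : Ideal A} (hp : p.IsPrime)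
    (hpI : p ≤ I) (hI : IsConvexIdeal I) (hrad : ∀ a : A, a * a ∈ I → a ∈ I)
    {a b : A} (hab : a * b ∈ I) : a ∈ I ∨ b ∈ I := by
  have h1 : |a| * |b| ∈ I := by
    apply hrad
    have h : |a| * |b| * (|a| * |b|) = a * b * (a * b) := by
      linear_combination (|b| * |b|) * abs_mul_abs_of_posPart_mul_negPart hpn a +
        (a * a) * abs_mul_abs_of_posPart_mul_negPart hpn b
    exact h ▸ I.mul_mem_left _ hab
  have hm0 : 0 ≤ |a| ⊓ |b| := le_inf (abs_nonneg a) (abs_nonneg b)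
  have h2 : |a| ⊓ |b| ∈ I := by
    refine hrad _ (hI (mul_nonneg hm0 hm0) ?_ h1)
    exact mul_le_mul inf_le_left inf_le_right hm0 (abs_nonneg a)
  refine (sub_inf_mem_or_sub_inf_mem hpn hp |a| |b|).imp (fun h => ?_) (fun h => ?_) <;>
  · refine hI.mem_of_abs_mem ?_
    have := I.add_mem (hpI h) h2
    rwa [sub_add_cancel] at this

theorem le_or_le_of_isPrime_of_le (hpn : ∀ a : A, a⁺ * a⁻ = 0)
    (hconv : ∀ p : Ideal A, p.IsPrime → IsConvexIdeal p) {p I J : Ideal A} (hp : p.IsPrime)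
    (hI : I.IsPrime) (hJ : J.IsPrime) (hpI : p ≤ I) (hpJ : p ≤ J) : I ≤ J ∨ J ≤ I := by
  by_contra! h
  obtain ⟨a, haI, haJ⟩ := Set.not_subset.1 h.1
  obtain ⟨b, hbJ, hbI⟩ := Set.not_subset.1 h.2
  have hm0 : 0 ≤ |a| ⊓ |b| := le_inf (abs_nonneg a) (abs_nonneg b)
  rcases sub_inf_mem_or_sub_inf_mem hpn hp |a| |b| with h | h
  · refine haJ ((hconv J hJ).mem_of_abs_mem ?_)
    have := J.add_mem (hpJ h) (hconv J hJ hm0 inf_le_right (abs_mem_of_mem hpn hJ hbJ))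
    rwa [sub_add_cancel] at this
  · refine hbI ((hconv I hI).mem_of_abs_mem ?_)
    have := I.add_mem (hpI h) (hconv I hI hm0 inf_le_left (abs_mem_of_mem hpn hI haI))
    rwa [sub_add_cancel] at this

end LatticeOrderedRing

/-! ### Prime ideals of real closed rings -/

namespace IsRealClosedRing

variable {A : Type*} [CommRing A]

/-- The prime ideals containing a given prime ideal of a real closed ring form a chain. -/
theorem le_or_le (h : IsRealClosedRing A) {p I J : Ideal A} (hp : p.IsPrime)
    (hI : I.IsPrime) (hJ : J.IsPrime) (hpI : p ≤ I) (hpJ : p ≤ J) : I ≤ J ∨ J ≤ I := by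
  obtain ⟨_, _, hsq, hmul, hdiv⟩ := h.order
  have hpn := posPart_mul_negPart (fun a => (hsq _).2 ⟨a, rfl⟩) hmul
  refine le_or_le_of_isPrime_of_le hpn (fun p hp a b ha hab hb => ?_) hp hI hJ hpI hpJ
  -- The divisibility axiom yields convexity of primes: `b ∈ p` puts `a ^ 2 = b * c` in `p`.
  obtain ⟨c, hc⟩ := hdiv a b ha hab
  exact hp.mem_of_pow_mem 2 (hc ▸ p.mul_mem_right _ hb)

/-- In a real closed ring the sum of two prime ideals is prime, unless it is the whole ring. -/
theorem isPrime_add (h : IsRealClosedRing A) {p q : Ideal A} (hp : p.IsPrime) (hq : q.IsPrime)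
    (htop : p + q ≠ ⊤) : (p + q).IsPrime := by
  obtain ⟨_, _, hsq, hmul, hdiv⟩ := h.order
  have := h.reduced
  have hpn := posPart_mul_negPart (fun a => (hsq _).2 ⟨a, rfl⟩) hmul
  have hconv : ∀ p : Ideal A, p.IsPrime → IsConvexIdeal p := by
    intro p hp a b ha hab hb
    obtain ⟨c, hc⟩ := hdiv a b ha hab
    exact hp.mem_of_pow_mem 2 (hc ▸ p.mul_mem_right _ hb)
  refine ⟨htop, fun {a b} hab => mem_or_mem_of_mul_mem hpn hp le_sup_left
    (IsConvexIdeal.add hpn hp hq (hconv p hp) (hconv q hq)) (fun a ha => ?_) hab⟩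
  exact mem_add_of_mul_self_mem hsq hpn hp hq (hconv p hp) (hconv q hq) ha

end IsRealClosedRing

end BranchRCR

/-! ### Minimal primes as annihilators -/

namespace BranchRCR

open Ideal

variable {A : Type*} [CommRing A]

theorem mem_torsionOf_self {a x : A} : x ∈ torsionOf A A a ↔ x * a = 0 := Iff.rfl

/-- A family of pairwise orthogonal elements whose annihilators are prime ideals with zero
intersection. -/
structure IsOrthogonalPrimeFamily {ι : Type*} (a : ι → A) : Prop where
  orthogonal : ∀ i j, i ≠ j → a i * a j = 0
  ne_zero : ∀ i, a i ≠ 0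
  mul_mul : ∀ i x y, x * y * a i = 0 → x * a i = 0 ∨ y * a i = 0
  eq_zero : ∀ x, (∀ i, x * a i = 0) → x = 0

namespace IsOrthogonalPrimeFamily

variable {ι : Type*} {a : ι → A}

theorem isPrime (ha : IsOrthogonalPrimeFamily a) (i : ι) : (torsionOf A A (a i)).IsPrime := by
  refine ⟨fun h => ha.ne_zero i ?_, fun {x y} => ha.mul_mul i x y⟩
  have := (Ideal.eq_top_iff_one _).1 h
  rwa [mem_torsionOf_self, one_mul] at this

/-- A prime contains the zero intersection of finitely many annihilators, hence one of them.
Distinct indices give incomparable annihilators: `a j` kills `a i` but, by reducedness, not itself.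
-/
theorem mem_minimalPrimes_iff [Finite ι] [IsReduced A] (ha : IsOrthogonalPrimeFamily a)
    {p : Ideal A} : p ∈ minimalPrimes A ↔ ∃ i, p = torsionOf A A (a i) := by
  cases nonempty_fintype ι
  have key : ∀ q : Ideal A, q.IsPrime → ∃ i, torsionOf A A (a i) ≤ q := by
    intro q hq
    have : Finset.univ.inf (fun i => torsionOf A A (a i)) ≤ q := by
      intro x hx
      rw [ha.eq_zero x fun i => (Submodule.mem_finsetInf.1 hx) i (Finset.mem_univ i)]
      exact q.zero_mem
    obtain ⟨i, -, hi⟩ := (hq.inf_le').1 this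
    exact ⟨i, hi⟩
  have hinc : ∀ i j, torsionOf A A (a i) ≤ torsionOf A A (a j) → i = j := by
    intro i j h
    by_contra hij
    have h1 : a j * a j = 0 := h (ha.orthogonal j i (Ne.symm hij))
    exact ha.ne_zero j (eq_zero_of_pow_eq_zero (n := 2) (by rw [pow_two, h1]))
  rw [minimalPrimes_eq_minimals]
  constructor
  · intro hp
    obtain ⟨i, hi⟩ := key p hp.prop
    exact ⟨i, (hp.le_of_le (ha.isPrime i) hi).antisymm hi⟩
  · rintro ⟨i, rfl⟩
    refine ⟨ha.isPrime i, fun q hq hqi => ?_⟩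
    obtain ⟨j, hj⟩ := key q hq
    obtain rfl := hinc j i (hj.trans hqi)
    exact hj

end IsOrthogonalPrimeFamily

/-- Minimal primes are incomparable, so some `a i` lies in every `p j` with `j ≠ i` but not in `p
i`. The `p i` intersect in zero, so `x * a i = 0` exactly when `x ∈ p i`. -/
theorem exists_isOrthogonalPrimeFamily [IsReduced A] {ι : Type*} [Finite ι] {p : ι → Ideal A}
    (hinj : Function.Injective p) (hp : Set.range p = minimalPrimes A) :
    ∃ a : ι → A, IsOrthogonalPrimeFamily a ∧ ∀ i, torsionOf A A (a i) = p i := by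
  classical
  cases nonempty_fintype ι
  have hmin : ∀ i, Minimal Ideal.IsPrime (p i) := fun i => by
    have : p i ∈ minimalPrimes A := hp ▸ Set.mem_range_self i
    rwa [minimalPrimes_eq_minimals] at this
  have hzero : ∀ x, (∀ i, x ∈ p i) → x = 0 := by
    intro x hx
    have h1 : x ∈ sInf ((⊥ : Ideal A).minimalPrimes) := by
      refine Submodule.mem_sInf.2 fun q hq => ?_
      obtain ⟨i, rfl⟩ : q ∈ Set.range p := hp ▸ hq
      exact hx i
    rw [Ideal.sInf_minimalPrimes] at h1
    obtain ⟨n, hn⟩ := h1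
    exact eq_zero_of_pow_eq_zero hn
  have hex : ∀ i, ∃ a, a ∉ p i ∧ ∀ j, j ≠ i → a ∈ p j := by
    intro i
    have : ¬ (Finset.univ.erase i).inf p ≤ p i := by
      rw [(hmin i).prop.inf_le']
      rintro ⟨j, hj, hji⟩
      exact Finset.ne_of_mem_erase hj (hinj (hji.antisymm ((hmin i).le_of_le (hmin j).prop hji)))
    obtain ⟨a, ha, hai⟩ := Set.not_subset.1 this
    exact ⟨a, hai, fun j hj => (Submodule.mem_finsetInf.1 ha) j (by simp [hj])⟩
  choose a hai haj using hex
  have hann : ∀ i, torsionOf A A (a i) = p i := by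
    intro i
    ext x
    rw [mem_torsionOf_self]
    refine ⟨fun h => ?_, fun h => hzero _ fun j => ?_⟩
    · exact ((hmin i).prop.mem_or_mem (h ▸ (p i).zero_mem)).resolve_right (hai i)
    · by_cases hj : j = i
      · subst hj
        exact (p j).mul_mem_right _ h
      · exact (p j).mul_mem_left _ (haj i j hj)
  refine ⟨a, ⟨fun i j hij => ?_, fun i h => hai i (h ▸ (p i).zero_mem), fun i x y h => ?_,
    fun x hx => hzero x fun i => ?_⟩, hann⟩
  · rw [← mem_torsionOf_self, hann]
    exact haj i j hij.symm
  · simp only [← mem_torsionOf_self, hann] at h ⊢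
    exact (hmin i).prop.mem_or_mem h
  · rw [← hann]
    exact hx i

/-- The maximal ideal and the pairwise sums of the annihilators of a family of elements. -/
def familyIdeal [IsLocalRing A] {ι : Type*} (a : ι → A) : Option (ι × ι) → Ideal A
  | none => IsLocalRing.maximalIdeal A
  | some (i, j) => torsionOf A A (a i) + torsionOf A A (a j)

theorem finite_minimalPrimes [IsLocalRing A] (h : ringRank A < ⊤) : (minimalPrimes A).Finite := by
  have h1 : rankAt A (IsLocalRing.closedPoint A) < ⊤ :=
    (le_iSup (fun p => rankAt A p) _).trans_lt h
  have h2 := Set.encard_lt_top_iff.1 h1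
  refine (h2.image PrimeSpectrum.asIdeal).subset fun p hp => ?_
  have hp' : p.IsPrime := hp.1.1
  exact ⟨⟨p, hp'⟩, ⟨hp, IsLocalRing.le_maximalIdeal hp'.ne_top⟩, rfl⟩

/-! ### The branching spectrum from minimal primes -/

namespace IsRealClosedRing

variable [IsLocalRing A]

theorem isPrime_add_of_isLocalRing (h : IsRealClosedRing A) {p q : Ideal A} (hp : p.IsPrime)
    (hq : q.IsPrime) : (p + q).IsPrime := by
  refine h.isPrime_add hp hq fun htop => (IsLocalRing.maximalIdeal.isMaximal A).ne_top ?_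
  rw [eq_top_iff, ← htop]
  exact sup_le (IsLocalRing.le_maximalIdeal hp.ne_top) (IsLocalRing.le_maximalIdeal hq.ne_top)

/-- The branching ideals of a local real closed ring are the sums of two distinct minimal prime
ideals. -/
theorem isBranchingIdeal_iff (h : IsRealClosedRing A) (q : PrimeSpectrum A) :
    IsBranchingIdeal q ↔ ∃ p₁ ∈ minimalPrimes A, ∃ p₂ ∈ minimalPrimes A,
      p₁ ≠ p₂ ∧ q.asIdeal = p₁ + p₂ := by
  constructor
  · rintro ⟨q₁, q₂, -, h₁, h₂, hq⟩
    obtain ⟨p₁, hp₁, hpq₁⟩ := Ideal.exists_minimalPrimes_le (I := ⊥) (J := q₁.asIdeal) bot_le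
    obtain ⟨p₂, hp₂, hpq₂⟩ := Ideal.exists_minimalPrimes_le (I := ⊥) (J := q₂.asIdeal) bot_le
    -- A prime below both `q₁` and `q₂` would make them comparable, so their sum would be one of
    -- them rather than strictly larger.
    have hno : ∀ p : Ideal A, p.IsPrime → p ≤ q₁.asIdeal → ¬ p ≤ q₂.asIdeal := by
      intro p hp hp1 hp2
      rcases h.le_or_le hp q₁.2 q₂.2 hp1 hp2 with h12 | h21
      · rw [Submodule.add_eq_sup, sup_eq_right.2 h12] at hq
        exact h₂.ne (PrimeSpectrum.ext hq.symm)
      · rw [Submodule.add_eq_sup, sup_eq_left.2 h21] at hq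
        exact h₁.ne (PrimeSpectrum.ext hq.symm)
    have hs := h.isPrime_add_of_isLocalRing hp₁.1.1 hp₂.1.1
    refine ⟨p₁, hp₁, p₂, hp₂, fun heq => hno p₁ hp₁.1.1 hpq₁ (heq ▸ hpq₂), le_antisymm ?_ ?_⟩
    · rw [hq]
      refine sup_le ?_ ?_
      -- `q₁` and `p₁ + p₂` both lie above `p₁`, hence are comparable; `p₁ + p₂ ≤ q₁` would put `p₂`
      -- below both `q₁` and `q₂`.
      · refine (h.le_or_le hp₁.1.1 q₁.2 hs hpq₁ le_sup_left).resolve_right fun hle => ?_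
        exact hno p₂ hp₂.1.1 (le_sup_right.trans hle) hpq₂
      · refine (h.le_or_le hp₂.1.1 q₂.2 hs hpq₂ le_sup_right).resolve_right fun hle => ?_
        exact hno p₁ hp₁.1.1 hpq₁ (le_sup_left.trans hle)
    · rw [hq]
      exact sup_le_sup hpq₁ hpq₂
  · rintro ⟨p₁, hp₁, p₂, hp₂, hne, hq⟩
    have hinc : ∀ {p p' : Ideal A}, p ∈ minimalPrimes A → p' ∈ minimalPrimes A → p ≤ p' →
        p = p' := fun hp hp' hle => hle.antisymm (hp'.2 hp.1 hle)
    refine ⟨⟨p₁, hp₁.1.1⟩, ⟨p₂, hp₂.1.1⟩, fun heq => hne (congrArg PrimeSpectrum.asIdeal heq),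
      lt_of_le_of_ne ?_ fun heq => ?_, lt_of_le_of_ne ?_ fun heq => ?_, hq⟩
    · exact hq.ge.trans' le_sup_left
    · rw [← heq] at hq
      exact hne (hinc hp₂ hp₁ (hq.ge.trans' le_sup_right)).symm
    · exact hq.ge.trans' le_sup_right
    · rw [← heq] at hq
      exact hne (hinc hp₁ hp₂ (hq.ge.trans' le_sup_left))

theorem mem_brSpec_iff (h : IsRealClosedRing A) {ι : Type*} [Finite ι] {a : ι → A}
    (ha : IsOrthogonalPrimeFamily a) (q : PrimeSpectrum A) :
    q ∈ BrSpec A ↔ ∃ s, q.asIdeal = familyIdeal a s := by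
  have := h.reduced
  have hcl : q = IsLocalRing.closedPoint A ↔ q.asIdeal = IsLocalRing.maximalIdeal A :=
    PrimeSpectrum.ext_iff
  simp only [BrSpec, Set.mem_union, Set.mem_ofPred_eq, Set.mem_singleton_iff,
    h.isBranchingIdeal_iff, hcl]
  constructor
  · rintro ((hq | hq) | ⟨p₁, hp₁, p₂, hp₂, -, hq⟩)
    · obtain ⟨i, hi⟩ := ha.mem_minimalPrimes_iff.1 hq
      -- The diagonal indices account for the minimal primes, as `I + I = I`.
      exact ⟨some (i, i), hi.trans (sup_idem _).symm⟩
    · exact ⟨none, hq⟩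
    · obtain ⟨i, rfl⟩ := ha.mem_minimalPrimes_iff.1 hp₁
      obtain ⟨j, rfl⟩ := ha.mem_minimalPrimes_iff.1 hp₂
      exact ⟨some (i, j), hq⟩
  · rintro ⟨_ | ⟨i, j⟩, hq⟩
    · exact Or.inl (Or.inr hq)
    · by_cases hij : torsionOf A A (a i) = torsionOf A A (a j)
      · refine Or.inl (Or.inl (ha.mem_minimalPrimes_iff.2 ⟨j, hq.trans ?_⟩))
        rw [familyIdeal, hij]
        exact sup_idem _
      · exact Or.inr ⟨_, ha.mem_minimalPrimes_iff.2 ⟨i, rfl⟩, _,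
          ha.mem_minimalPrimes_iff.2 ⟨j, rfl⟩, hij, hq⟩

theorem isPrime_familyIdeal (h : IsRealClosedRing A) {ι : Type*} {a : ι → A}
    (ha : IsOrthogonalPrimeFamily a) (s : Option (ι × ι)) : (familyIdeal a s).IsPrime := by
  rcases s with _ | ⟨i, j⟩
  · exact (IsLocalRing.maximalIdeal.isMaximal A).isPrime
  · exact h.isPrime_add_of_isLocalRing (ha.isPrime i) (ha.isPrime j)

end IsRealClosedRing

/-- Both posets are the quotient of `ι` by the same preorder. -/
theorem nonempty_orderIso_of_surjective {ι X Y : Type*} [PartialOrder X] [PartialOrder Y]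
    {f : ι → X} {g : ι → Y} (hf : Function.Surjective f) (hg : Function.Surjective g)
    (hfg : ∀ s t, f s ≤ f t ↔ g s ≤ g t) : Nonempty (X ≃o Y) := by
  let e : X ↪o Y := OrderEmbedding.ofMapLEIff (fun x => g (Function.surjInv hf x)) fun x y => by
    rw [← hfg, Function.surjInv_eq hf, Function.surjInv_eq hf]
  refine ⟨RelIso.ofSurjective e fun y => ?_⟩
  obtain ⟨s, rfl⟩ := hg y
  have h := Function.surjInv_eq hf (f s)
  exact ⟨f s, le_antisymm ((hfg _ _).1 h.le) ((hfg _ _).1 h.ge)⟩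

namespace IsRealClosedRing

variable [IsLocalRing A]

/-- The isomorphism type of the branching spectrum is determined by the inclusions between the
ideals attached to an orthogonal family. -/
theorem nonempty_brSpec_orderIso_iff (h : IsRealClosedRing A) (hr : ringRank A < ⊤)
    (P : Type*) [PartialOrder P] [Finite P] :
    Nonempty (BrSpec A ≃o P) ↔ ∃ n : Fin (Nat.card P + 1),
      ∃ f : {f : Option (Fin n × Fin n) → P // Function.Surjective f}, ∃ a : Fin n → A,
        IsOrthogonalPrimeFamily a ∧
        ∀ s t, familyIdeal a s ≤ familyIdeal a t ↔ f.1 s ≤ f.1 t := by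
  have hred := h.reduced
  have hsurj : ∀ {ι : Type} [Finite ι] {a : ι → A} (ha : IsOrthogonalPrimeFamily a),
      ∃ g : Option (ι × ι) → BrSpec A, Function.Surjective g ∧
        ∀ s, (g s).1.asIdeal = familyIdeal a s := by
    intro ι _ a ha
    refine ⟨fun s => ⟨⟨_, h.isPrime_familyIdeal ha s⟩, (h.mem_brSpec_iff ha _).2 ⟨s, rfl⟩⟩,
      fun q => ?_, fun s => rfl⟩
    obtain ⟨s, hs⟩ := (h.mem_brSpec_iff ha _).1 q.2
    exact ⟨s, Subtype.ext (PrimeSpectrum.ext hs.symm)⟩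
  constructor
  · rintro ⟨e⟩
    have hfin := finite_minimalPrimes hr
    have := hfin.to_subtype
    -- Minimal primes embed in `BrSpec A ≃o P`; this bound on their number keeps the disjunction
    -- over `n` finite.
    have hcard : Nat.card (minimalPrimes A) ≤ Nat.card P := by
      refine Nat.card_le_card_of_injective
        (fun p => e ⟨⟨p.1, p.2.1.1⟩, Or.inl (Or.inl p.2)⟩) fun p p' hpp => ?_
      have := e.injective hpp
      exact Subtype.ext (congrArg (fun x => x.1.asIdeal) this)
    let E := Finite.equivFin (minimalPrimes A)
    obtain ⟨a, ha, -⟩ := exists_isOrthogonalPrimeFamily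
      (p := fun i => (E.symm i).1) (Subtype.val_injective.comp E.symm.injective)
      (by rw [Set.range_comp' Subtype.val, E.symm.surjective.range_eq, Set.image_univ,
        Subtype.range_coe])
    obtain ⟨g, hg, hgi⟩ := hsurj ha
    refine ⟨⟨_, Nat.lt_succ_of_le hcard⟩, ⟨e ∘ g, e.surjective.comp hg⟩, a, ha, fun s t => ?_⟩
    rw [← hgi, ← hgi]
    exact e.le_iff_le.symm
  · rintro ⟨n, ⟨f, hf⟩, a, ha, hfa⟩
    obtain ⟨g, hg, hgi⟩ := hsurj ha
    refine nonempty_orderIso_of_surjective hg hf fun s t => ?_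
    rw [← hfa, ← hgi, ← hgi]
    exact Iff.rfl

end IsRealClosedRing

end BranchRCR

/-! ### First-order expression and the theorem -/

namespace BranchRCR

open FirstOrder FirstOrder.Language

section Formulas

variable {V ι : Type}

/-- The formula expressing membership of a term in an ideal of `familyIdeal`. -/
noncomputable def memFormula (a : ι → Language.ring.Term V) (x : Language.ring.Term V) :
    Option (ι × ι) → Language.ring.Formula V
  | none => ∼(Formula.iExs Unit (Term.equal (x.relabel Sum.inl * Term.var (Sum.inr ())) 1))
  | some (i, j) => Formula.iExs Bool
      (Term.equal (Term.var (Sum.inr false) * (a i).relabel Sum.inl) 0 ⊓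
        Term.equal (Term.var (Sum.inr true) * (a j).relabel Sum.inl) 0 ⊓
        Term.equal (Term.var (Sum.inr false) + Term.var (Sum.inr true)) (x.relabel Sum.inl))

theorem realize_memFormula {A : Type*} [CommRing A] [IsLocalRing A] [Ring.CompatibleRing A]
    (a : ι → Language.ring.Term V) (x : Language.ring.Term V) (s : Option (ι × ι)) (v : V → A) :
    (memFormula a x s).Realize v ↔
      x.realize v ∈ familyIdeal (fun i => (a i).realize v) s := by
  rcases s with _ | ⟨i, j⟩
  · simp only [memFormula, familyIdeal, Formula.realize_not, Formula.realize_iExs,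
      Formula.realize_equal, Ring.realize_mul, Ring.realize_one, Term.realize_relabel,
      Term.realize_var, Sum.elim_inr, Sum.elim_comp_inl, IsLocalRing.mem_maximalIdeal,
      mem_nonunits_iff, isUnit_iff_exists_inv]
    exact not_congr ⟨fun ⟨i, hi⟩ => ⟨i (), hi⟩, fun ⟨b, hb⟩ => ⟨fun _ => b, hb⟩⟩
  · simp only [memFormula, familyIdeal, Formula.realize_inf, Formula.realize_iExs,
      Formula.realize_equal, Ring.realize_mul, Ring.realize_add, Ring.realize_zero,
      Term.realize_relabel, Term.realize_var, Sum.elim_inr, Sum.elim_comp_inl,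
      Submodule.add_eq_sup, Submodule.mem_sup, mem_torsionOf_self]
    constructor
    · rintro ⟨y, ⟨h1, h2⟩, h3⟩
      exact ⟨_, h1, _, h2, h3⟩
    · rintro ⟨y, h1, z, h2, h3⟩
      exact ⟨fun b => bif b then z else y, ⟨h1, h2⟩, h3⟩

/-- The formula expressing the inclusion of two ideals of `familyIdeal`. -/
noncomputable def leFormula (s t : Option (ι × ι)) : Language.ring.Formula ι :=
  Formula.iAlls Unit
    ((memFormula (fun i => Term.var (Sum.inl i)) (Term.var (Sum.inr ())) s).imp
      (memFormula (fun i => Term.var (Sum.inl i)) (Term.var (Sum.inr ())) t))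

theorem realize_leFormula {A : Type*} [CommRing A] [IsLocalRing A] [Ring.CompatibleRing A]
    (s t : Option (ι × ι)) (a : ι → A) :
    (leFormula s t).Realize a ↔ familyIdeal a s ≤ familyIdeal a t := by
  simp only [leFormula, Formula.realize_iAlls, Formula.realize_imp, realize_memFormula,
    Term.realize_var, Sum.elim_inl, Sum.elim_inr]
  exact ⟨fun h x => h fun _ => x, fun h i => @h (i ())⟩

/-- The formula expressing that a finite family is an orthogonal family with prime annihilators
of zero intersection. -/
noncomputable def orthogonalFormula (ι : Type) [Finite ι] : Language.ring.Formula ι :=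
  Formula.iInf (fun k : {k : ι × ι // k.1 ≠ k.2} =>
    Term.equal (Term.var k.1.1 * Term.var k.1.2) 0) ⊓
  Formula.iInf (fun i : ι => ∼(Term.equal (Term.var i) 0)) ⊓
  Formula.iInf (fun i : ι => Formula.iAlls Bool
    ((Term.equal (Term.var (Sum.inr false) * Term.var (Sum.inr true) * Term.var (Sum.inl i)) 0).imp
      (Term.equal (Term.var (Sum.inr false) * Term.var (Sum.inl i)) 0 ⊔
        Term.equal (Term.var (Sum.inr true) * Term.var (Sum.inl i)) 0))) ⊓
  Formula.iAlls Unit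
    ((Formula.iInf fun i : ι => Term.equal (Term.var (Sum.inr ()) * Term.var (Sum.inl i)) 0).imp
      (Term.equal (Term.var (Sum.inr ())) 0))

theorem realize_orthogonalFormula {A : Type*} [CommRing A] [Ring.CompatibleRing A] [Finite ι]
    (a : ι → A) : (orthogonalFormula ι).Realize a ↔ IsOrthogonalPrimeFamily a := by
  simp only [orthogonalFormula, Formula.realize_inf, Formula.realize_sup, Formula.realize_iInf,
    Formula.realize_iAlls, Formula.realize_imp, Formula.realize_not, Formula.realize_equal,
    Ring.realize_mul, Ring.realize_zero, Term.realize_var, Sum.elim_inl, Sum.elim_inr]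
  constructor
  · rintro ⟨⟨⟨h1, h2⟩, h3⟩, h4⟩
    exact ⟨fun i j hij => h1 ⟨(i, j), hij⟩, h2,
      fun i x y => h3 i fun b => bif b then y else x, fun x => h4 fun _ => x⟩
  · rintro ⟨h1, h2, h3, h4⟩
    exact ⟨⟨⟨fun k => h1 _ _ k.2, h2⟩, fun i x => h3 i _ _⟩, fun x => h4 _⟩

end Formulas

/-- A sentence that holds in a local real closed ring of finite rank if and only if its branching
spectrum is isomorphic to the given finite poset. -/
noncomputable def branchSentence (P : Type*) [PartialOrder P] [Finite P] :
    Language.ring.Sentence :=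
  open scoped Classical in
  Formula.iSup fun n : Fin (Nat.card P + 1) =>
    Formula.iSup fun f : {f : Option (Fin n × Fin n) → P // Function.Surjective f} =>
      Formula.iExs (Fin n) <| Formula.relabel Sum.inr <|
        orthogonalFormula (Fin n) ⊓
        Formula.iInf fun k : Option (Fin n × Fin n) × Option (Fin n × Fin n) =>
          if f.1 k.1 ≤ f.1 k.2 then leFormula k.1 k.2 else ∼(leFormula k.1 k.2)

theorem realize_branchSentence (P : Type*) [PartialOrder P] [Finite P]
    (A : Type*) [CommRing A] [IsLocalRing A] [Ring.CompatibleRing A]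
    (h : IsRealClosedRing A) (hr : ringRank A < ⊤) :
    A ⊨ branchSentence P ↔ Nonempty (BrSpec A ≃o P) := by
  rw [h.nonempty_brSpec_orderIso_iff hr P, Sentence.Realize, branchSentence]
  simp only [Formula.realize_iSup, Formula.realize_iExs, Formula.realize_relabel,
    Sum.elim_comp_inr, Formula.realize_inf, Formula.realize_iInf, realize_orthogonalFormula]
  refine exists_congr fun n => exists_congr fun f => exists_congr fun a =>
    and_congr_right fun _ => Prod.forall.trans <| forall₂_congr fun s t => ?_
  split_ifs with hst
  · simp [realize_leFormula, hst]
  · simp [realize_leFormula, hst]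

theorem finite_brSpec (A : Type*) [CommRing A] [IsLocalRing A] (h : IsRealClosedRing A)
    (hr : ringRank A < ⊤) : Finite (BrSpec A) := by
  have hfin := finite_minimalPrimes hr
  have hb : {q : PrimeSpectrum A | IsBranchingIdeal q}.Finite := by
    refine Set.Finite.of_finite_image (f := PrimeSpectrum.asIdeal)
      ((Set.Finite.image2 (· + ·) hfin hfin).subset ?_)
      fun _ _ _ _ => PrimeSpectrum.ext
    rintro _ ⟨q, hq, rfl⟩
    obtain ⟨p₁, hp₁, p₂, hp₂, -, hq⟩ := (h.isBranchingIdeal_iff q).1 hq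
    exact ⟨p₁, hp₁, p₂, hp₂, hq.symm⟩
  have hm : {q : PrimeSpectrum A | q.asIdeal ∈ minimalPrimes A}.Finite :=
    hfin.preimage fun _ _ _ _ => PrimeSpectrum.ext
  exact ((hm.union (Set.finite_singleton _)).union hb).to_subtype

end BranchRCR

theorem mainTheorem6 :
    (∀ (P : Type w) [PartialOrder P] [Finite P],
      BranchRCR.IsReducedRoot P → 2 ≤ BranchRCR.rootRank P →
      ∃ φ : FirstOrder.Language.ring.Sentence,
        ∀ (A : Type u) [CommRing A] [IsLocalRing A] [FirstOrder.Ring.CompatibleRing A],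
          BranchRCR.IsRealClosedRing A → BranchRCR.ringRank A < ⊤ →
          (A ⊨ φ ↔ Nonempty (BranchRCR.BrSpec A ≃o P))) ∧
    (∀ (A : Type u) [CommRing A] [IsLocalRing A] [FirstOrder.Ring.CompatibleRing A]
      (B : Type v) [CommRing B] [IsLocalRing B] [FirstOrder.Ring.CompatibleRing B],
      BranchRCR.IsRealClosedRing A → BranchRCR.ringRank A < ⊤ →
      BranchRCR.IsRealClosedRing B → BranchRCR.ringRank B < ⊤ →
      A ≅[FirstOrder.Language.ring] B →
      Nonempty (BranchRCR.BrSpec A ≃o BranchRCR.BrSpec B)) := by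
  refine ⟨fun P _ _ _ _ => ⟨BranchRCR.branchSentence P, fun A _ _ _ h hr =>
    BranchRCR.realize_branchSentence P A h hr⟩, fun A _ _ _ B _ _ _ hA hrA hB hrB hAB => ?_⟩
  have := BranchRCR.finite_brSpec A hA hrA
  -- The sentence is available for any finite poset, in particular for the branching spectrum of `A`
  -- itself.
  have h1 : A ⊨ BranchRCR.branchSentence (BranchRCR.BrSpec A) :=
    (BranchRCR.realize_branchSentence _ A hA hrA).2 ⟨OrderIso.refl _⟩
  have h2 := (hAB.realize_sentence _).1 h1
  exact ((BranchRCR.realize_branchSentence _ B hB hrB).1 h2).map OrderIso.symm
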